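/- Let $K$ be a field, $S=K[x_1,\dots,x_n]$, $\mathfrak m=(x_1,\dots,x_n)$, and let $I\subset S$ be an equigenerated monomial ideal, that is, an ideal generated by monomials that can also be generated by homogeneous polynomials of one and the same degree (equivalently, by monomials of one and the same degree). Let $\mathcal R(I)=\bigoplus_{k\ge 0}I^kt^k\subset S[t]$ be the Rees ring of $I$, let $F(I)=\mathcal R(I)/\mathfrak m\mathcal R(I)=\bigoplus_{k\ge 0}(I^k/\mathfrak m I^k)t^k$ be its fiber ring, and let $\ell(I)=\dim F(I)$ be the Krull dimension of $F(I)$ (the analytic spread of $I$). Write the Hilbert series of the standard graded $K$-algebra $F(I)$ as \[ \sum_{k\ge 0}\dim_K\bigl(I^k/\mathfrak m I^k\bigr)\,t^k=\frac{Q(t)}{(1-t)^{\ell(I)}},\qquad Q(t)=\sum_{i\ge 0}h_it^i, \] so that $(h_0,h_1,h_2,\dots)$ is the $h$-vector of $F(I)$. Then $h_2\ge 0$. -/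

import Mathlib

noncomputable section

open MvPolynomial

/-- A monomial ideal: an ideal generated by a set of monomials `x ^ a`, `a ∈ A`. -/
def IsMonomialIdeal {K : Type*} [Field K] {n : ℕ} (I : Ideal (MvPolynomial (Fin n) K)) : Prop :=
  ∃ A : Set (Fin n →₀ ℕ), I = Ideal.span ((fun a => monomial a (1 : K)) '' A)

/-- An equigenerated ideal: an ideal generated by homogeneous polynomials of one degree `d`. -/
def IsEquigenerated {K : Type*} [Field K] {n : ℕ} (I : Ideal (MvPolynomial (Fin n) K)) : Prop :=
  ∃ (d : ℕ) (G : Set (MvPolynomial (Fin n) K)),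
    (∀ f ∈ G, f.IsHomogeneous d) ∧ I = Ideal.span G

/-- The extension `𝔪 R(I)` of `𝔪 = (x₁, …, xₙ)` to the Rees ring `R(I) = ⨁ Iᵏ tᵏ ⊆ S[t]`. -/
abbrev irrelevantReesIdeal {K : Type*} [Field K] {n : ℕ} (I : Ideal (MvPolynomial (Fin n) K)) :
    Ideal (reesAlgebra I) :=
  (idealOfVars (Fin n) K).map (algebraMap (MvPolynomial (Fin n) K) (reesAlgebra I))

/-- The fiber ring `F(I) = R(I) / 𝔪 R(I)`. -/
abbrev FiberRing {K : Type*} [Field K] {n : ℕ} (I : Ideal (MvPolynomial (Fin n) K)) : Type _ :=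
  reesAlgebra I ⧸ irrelevantReesIdeal I

/-- The `k`-th graded component `Iᵏ tᵏ` of the Rees ring. -/
def reesComponent {K : Type*} [Field K] {n : ℕ} (I : Ideal (MvPolynomial (Fin n) K)) (k : ℕ) :
    Submodule K (reesAlgebra I) where
  carrier := {f | ∃ r ∈ I ^ k, (f : Polynomial (MvPolynomial (Fin n) K)) = Polynomial.monomial k r}
  zero_mem' := ⟨0, zero_mem _, by simp⟩
  add_mem' := by
    rintro f g ⟨r, hr, hf⟩ ⟨s, hs, hg⟩
    exact ⟨r + s, add_mem hr hs, by simp [hf, hg]⟩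
  smul_mem' := by
    rintro c f ⟨r, hr, hf⟩
    exact ⟨c • r, Submodule.smul_of_tower_mem _ c hr, by
      rw [← Polynomial.smul_monomial, ← hf]; rfl⟩

/-- The `k`-th graded component of the fiber ring, the image of `Iᵏ tᵏ` in `F(I)`. -/
def fiberComponent {K : Type*} [Field K] {n : ℕ} (I : Ideal (MvPolynomial (Fin n) K)) (k : ℕ) :
    Submodule K (FiberRing I) :=
  (reesComponent I k).map (Ideal.Quotient.mkₐ K (irrelevantReesIdeal I)).toLinearMap

/-- The Hilbert series of the fiber ring. -/
def fiberHilbertSeries {K : Type*} [Field K] {n : ℕ} (I : Ideal (MvPolynomial (Fin n) K)) :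
    PowerSeries ℤ :=
  PowerSeries.mk fun k => (Module.finrank K (fiberComponent I k) : ℤ)

/-- The analytic spread of `I`, that is, the Krull dimension of the fiber ring, as a natural number.
It is the true dimension: see `coe_analyticSpread`. -/
def analyticSpread {K : Type*} [Field K] {n : ℕ} (I : Ideal (MvPolynomial (Fin n) K)) : ℕ :=
  ((ringKrullDim (FiberRing I)).unbotD 0).toNat

/-- The `i`-th entry `hᵢ` of the `h`-vector of the fiber ring: the coefficient of `tⁱ` in
`Q(t) = (1 - t) ^ ℓ(I) * Hilb_{F(I)}(t)`. -/
def fiberHVector {K : Type*} [Field K] {n : ℕ} (I : Ideal (MvPolynomial (Fin n) K)) (i : ℕ) : ℤ :=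
  PowerSeries.coeff i ((1 - PowerSeries.X) ^ analyticSpread I * fiberHilbertSeries I)

theorem fiberRing_nontrivial {K : Type*} [Field K] {n : ℕ} (I : Ideal (MvPolynomial (Fin n) K)) :
    Nontrivial (FiberRing I) := by
  refine Ideal.Quotient.nontrivial_iff.mpr fun h => ?_
  let φ : reesAlgebra I →+* K :=
    ((constantCoeff (R := K) (σ := Fin n)).comp Polynomial.constantCoeff).comp
      (reesAlgebra I).val.toRingHom
  have hle : irrelevantReesIdeal I ≤ RingHom.ker φ := by
    rw [irrelevantReesIdeal, Ideal.map_le_iff_le_comap, idealOfVars, Ideal.span_le]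
    rintro _ ⟨i, rfl⟩
    change φ _ = 0
    simp [φ]
  have h1 : (1 : reesAlgebra I) ∈ RingHom.ker φ := hle (h ▸ Submodule.mem_top)
  simp [RingHom.mem_ker] at h1

theorem coe_analyticSpread {K : Type*} [Field K] {n : ℕ} (I : Ideal (MvPolynomial (Fin n) K)) :
    ((analyticSpread I : ℕ) : WithBot ℕ∞) = ringKrullDim (FiberRing I) := by
  have := fiberRing_nontrivial I
  have : Algebra.FiniteType K (reesAlgebra I) :=
    Algebra.FiniteType.trans (S := MvPolynomial (Fin n) K) inferInstance inferInstance
  obtain ⟨m, f, hf⟩ := (Algebra.FiniteType.iff_quotient_mvPolynomial'' (R := K)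
    (S := reesAlgebra I)).mp inferInstance
  have hle : ringKrullDim (FiberRing I) ≤ ringKrullDim (MvPolynomial (Fin m) K) :=
    ringKrullDim_le_of_surjective
      ((Ideal.Quotient.mk (irrelevantReesIdeal I)).comp f.toRingHom)
      (Ideal.Quotient.mk_surjective.comp hf)
  rw [MvPolynomial.ringKrullDim_of_isNoetherianRing, ringKrullDim_eq_zero_of_field] at hle
  have h0 : (0 : WithBot ℕ∞) ≤ ringKrullDim (FiberRing I) := ringKrullDim_nonneg_of_nontrivial
  rw [analyticSpread]
  generalize ringKrullDim (FiberRing I) = e at *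
  induction e with
  | bot => simp at h0
  | coe e =>
    induction e with
    | top =>
      rw [zero_add, Nat.card_fin] at hle
      exact absurd (top_le_iff.mp (WithBot.coe_le_coe.mp hle)) (ENat.natCast_ne_top m)
    | coe e => rfl

/-- If `Hilb_{F(I)}(t) = Q(t) / (1 - t) ^ ℓ(I)` with a polynomial `Q`, then `hᵢ` is the `i`-th
coefficient of `Q`. -/
theorem fiberHVector_eq_coeff {K : Type*} [Field K] {n : ℕ} (I : Ideal (MvPolynomial (Fin n) K))
    (Q : Polynomial ℤ)
    (hQ : fiberHilbertSeries I = (Q : PowerSeries ℤ) * PowerSeries.invOneSubPow ℤ (analyticSpread I))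
    (i : ℕ) : fiberHVector I i = Q.coeff i := by
  have h : (1 - PowerSeries.X : PowerSeries ℤ) ^ analyticSpread I
      * PowerSeries.invOneSubPow ℤ (analyticSpread I) = 1 := by
    rw [← PowerSeries.invOneSubPow_inv_eq_one_sub_pow]
    exact Units.inv_val _
  rw [fiberHVector, hQ, mul_left_comm, h, mul_one, Polynomial.coeff_coe]

end

/-!
Let `X` be the set of exponents of the generators of `I`, all of one degree `d`. Then `F(I)` has in
degree `k` a basis consisting of the monomials of degree `k d` in `Iᵏ`, so its Hilbert function
starts with `1, |X|, |X + X|` and `h₂ = |X + X| - ℓ |X| + (ℓ choose 2)` for `ℓ = ℓ(I)`.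

If `r` is the rank of the vectors `(1, u)`, `u ∈ X`, Freiman's inequality reads
`r |X| ≤ |X + X| + (r choose 2)`. The fiber ring is a quotient of the semigroup ring of the monoid
generated by these vectors, which has dimension at most `r`; hence `ℓ ≤ r ≤ |X|`. In the range
`l ≤ |X|` the quantity `l |X| - (l choose 2)` is nondecreasing in `l`, so `ℓ` may replace `r`.
-/

section Freiman

open scoped Pointwise
open Module (finrank)

theorem card_add_card_le_card_insert_add_insert {M : Type*} [AddCommMonoid M] [IsCancelAdd M]
    [DecidableEq M] {s t : Finset M} {v : M} (hts : t ⊆ insert v s)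
    (ht : ∀ x ∈ t, v + x ∉ s + s) :
    (s + s).card + t.card ≤ (insert v s + insert v s).card := by
  have hdisj : Disjoint (s + s) (t.image (v + ·)) := by
    simpa [Finset.disjoint_right] using ht
  have hsub : (s + s) ∪ t.image (v + ·) ⊆ insert v s + insert v s := by
    refine Finset.union_subset ?_ (Finset.image_subset_iff.mpr ?_)
    · exact Finset.add_subset_add (Finset.subset_insert v s) (Finset.subset_insert v s)
    · exact fun x hx => Finset.add_mem_add (Finset.mem_insert_self v s) (hts hx)
  calc (s + s).card + t.card = ((s + s) ∪ t.image (v + ·)).card := by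
        rw [Finset.card_union_of_disjoint hdisj,
          Finset.card_image_of_injective t (add_right_injective v)]
    _ ≤ _ := Finset.card_le_card hsub

theorem add_notMem_add_of_notMem_span {k M V : Type*} [Ring k] [AddCommGroup V] [Module k V]
    [AddCommMonoid M] [DecidableEq M] {s : Finset M} {v : M} {f : M → V}
    (hf : IsAddFreimanHom 2 (insert v s : Set M) Set.univ f)
    (hfv : f v ∉ Submodule.span k (f '' s)) {x : M} (hx : x ∈ s) : v + x ∉ s + s := fun h => by
  have hmem : ∀ y ∈ s, f y ∈ Submodule.span k (f '' s) := fun y hy =>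
    Submodule.subset_span (Set.mem_image_of_mem f hy)
  obtain ⟨y, hy, z, hz, hyz⟩ := Finset.mem_add.mp h
  have hfvx : f v + f x = f y + f z :=
    hf.add_eq_add (.inl rfl) (.inr hx) (.inr hy) (.inr hz) hyz.symm
  exact hfv (eq_sub_of_add_eq hfvx ▸ sub_mem (add_mem (hmem y hy) (hmem z hz)) (hmem x hx))

theorem finrank_span_insert_of_notMem {k V : Type*} [DivisionRing k] [AddCommGroup V] [Module k V]
    {s : Set V} {v : V} (hs : s.Finite) (hv : v ∉ Submodule.span k s) :
    finrank k (Submodule.span k (insert v s)) = finrank k (Submodule.span k s) + 1 := by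
  have hv0 : v ≠ 0 := fun h => hv (h ▸ zero_mem _)
  have hinf : Submodule.span k {v} ⊓ Submodule.span k s = ⊥ :=
    ((Submodule.disjoint_span_singleton' hv0).mpr hv).symm.eq_bot
  have := Module.Finite.span_of_finite k hs
  have hsup := Submodule.finrank_sup_add_finrank_inf_eq (Submodule.span k {v}) (Submodule.span k s)
  rw [hinf, finrank_bot, add_zero, finrank_span_singleton hv0, ← Submodule.span_insert] at hsup
  rw [hsup, add_comm]

section LowerBound

variable {k M V : Type*} [DivisionRing k] [AddCommGroup V] [Module k V]
  [AddCommMonoid M] [LinearOrder M] [IsOrderedCancelAddMonoid M] [DecidableEq M]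
  {s : Finset M} {v : M} {f : M → V}

theorem add_self_notMem_add_of_forall_lt (hv : ∀ x ∈ s, v < x) : v + v ∉ s + s := fun h => by
  obtain ⟨y, hy, z, hz, hyz⟩ := Finset.mem_add.mp h
  exact (add_lt_add (hv y hy) (hv z hz)).ne hyz.symm

/-- If `v + x = y + z` then `y, z < x`, so the elements `x` with `v + x ∈ s + s` are spanned
one after the other, from the smallest one upwards. -/
theorem span_image_le_span_image_insert_filter (hv : ∀ x ∈ s, v < x)
    (hf : IsAddFreimanHom 2 (insert v s : Set M) Set.univ f) :
    Submodule.span k (f '' s) ≤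
      Submodule.span k (f '' ↑(insert v (s.filter fun x => v + x ∉ s + s))) := by
  set W := Submodule.span k (f '' ↑(insert v (s.filter fun x => v + x ∉ s + s)))
  have hvW : f v ∈ W := Submodule.subset_span ⟨v, by simp, rfl⟩
  suffices ∀ x ∈ (s : Set M), f x ∈ W from Submodule.span_le.mpr (Set.image_subset_iff.mpr this)
  intro x hx
  refine s.finite_toSet.wellFoundedOn.induction (r := (· < ·)) (P := (f · ∈ W)) hx
    fun x hx ih => ?_
  by_cases hvx : v + x ∈ s + s
  · obtain ⟨y, hy, z, hz, hyz⟩ := Finset.mem_add.mp hvx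
    have hyx : y < x := by
      by_contra! h
      exact (add_lt_add_of_lt_of_le (hv z hz) h).ne (by rw [← hyz, add_comm])
    have hzx : z < x := by
      by_contra! h
      exact (add_lt_add_of_lt_of_le (hv y hy) h).ne hyz.symm
    have hfx : f x = f y + f z - f v := eq_sub_of_add_eq' <|
      hf.add_eq_add (.inl rfl) (.inr hx) (.inr hy) (.inr hz) hyz.symm
    rw [hfx]
    exact sub_mem (add_mem (ih y hy hyx) (ih z hz hzx)) hvW
  · exact Submodule.subset_span ⟨x, by simp_all, rfl⟩

/-- Freiman's inequality. -/
theorem finrank_span_image_mul_card_le (s : Finset M)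
    (hf : IsAddFreimanHom 2 (s : Set M) Set.univ f) :
    finrank k (Submodule.span k (f '' s)) * s.card ≤
      (s + s).card + (finrank k (Submodule.span k (f '' s))).choose 2 := by
  induction s using Finset.induction_on_min with
  | empty => simp
  | insert v s hv ih =>
    rw [Finset.coe_insert] at hf
    specialize ih (hf.subset (Set.subset_insert v _) (Set.mapsTo_univ f _))
    have hvs : v ∉ s := fun h => lt_irrefl v (hv v h)
    have hvv : v + v ∉ s + s := add_self_notMem_add_of_forall_lt hv
    rw [Finset.card_insert_of_notMem hvs, Finset.coe_insert, Set.image_insert_eq]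
    by_cases hfv : f v ∈ Submodule.span k (f '' s)
    · rw [Submodule.span_insert_eq_span hfv]
      set t := insert v (s.filter fun x => v + x ∉ s + s)
      have hsum : (s + s).card + t.card ≤ (insert v s + insert v s).card :=
        card_add_card_le_card_insert_add_insert
          (Finset.insert_subset_insert v (Finset.filter_subset _ s)) (by simp +contextual [t, hvv])
      have hrank : finrank k (Submodule.span k (f '' s)) ≤ t.card := by
        have := Module.Finite.span_of_finite k (t.finite_toSet.image f)
        calc finrank k (Submodule.span k (f '' s)) ≤ finrank k (Submodule.span k (f '' t)) :=
              Submodule.finrank_mono (span_image_le_span_image_insert_filter hv hf)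
          _ ≤ t.card := by
            classical
            rw [← Finset.coe_image]
            exact (finrank_span_finset_le_card _).trans Finset.card_image_le
      linarith
    · have hsum : (s + s).card + (s.card + 1) ≤ (insert v s + insert v s).card := by
        rw [← Finset.card_insert_of_notMem hvs]
        refine card_add_card_le_card_insert_add_insert subset_rfl ?_
        exact (Finset.forall_mem_insert ..).mpr
          ⟨hvv, fun x hx => add_notMem_add_of_notMem_span hf hfv hx⟩
      have hrank : finrank k (Submodule.span k (insert (f v) (f '' s))) =
          finrank k (Submodule.span k (f '' s)) + 1 :=
        finrank_span_insert_of_notMem (s.finite_toSet.image f) hfv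
      rw [hrank, Nat.choose_succ_succ', Nat.choose_one_right]
      linarith

end LowerBound

end Freiman

section KrullDimension

theorem ringKrullDim_le_of_isIntegral {R S : Type*} [CommRing R] [CommRing S] [Algebra R S]
    [Algebra.IsIntegral R S] : ringKrullDim S ≤ ringKrullDim R :=
  Order.krullDim_le_of_strictMono (PrimeSpectrum.comap (algebraMap R S)) fun _ _ h =>
    Ideal.IsIntegral.comap_lt_comap h

theorem ringKrullDim_le_of_trdeg_le {K A : Type*} [Field K] [CommRing A] [Nontrivial A]
    [Algebra K A] [Algebra.FiniteType K A] {r : ℕ} (h : Algebra.trdeg K A ≤ r) :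
    ringKrullDim A ≤ r := by
  obtain ⟨s, g, hg, hint⟩ := exists_integral_inj_algHom_of_fg K A
  have hs : s ≤ r := by
    simpa [MvPolynomial.trdeg_of_isDomain] using
      (lift_trdeg_le_of_injective g hg).trans (Cardinal.lift_le.mpr h)
  algebraize [g.toRingHom]
  calc ringKrullDim A ≤ ringKrullDim (MvPolynomial (Fin s) K) := ringKrullDim_le_of_isIntegral
    _ = s := by
      rw [MvPolynomial.ringKrullDim_of_isNoetherianRing, ringKrullDim_eq_zero_of_field, zero_add,
        Nat.card_fin]
    _ ≤ r := by exact_mod_cast hs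

end KrullDimension

section AddMonoidAlgebra

open Module (finrank)
open scoped AddMonoidAlgebra

theorem exists_nsmul_add_eq_of_mem_span {V : Type*} [AddCommGroup V] [Module ℚ V]
    {P : AddSubmonoid V} {x : V} (hx : x ∈ Submodule.span ℚ (P : Set V)) :
    ∃ N : ℕ, N ≠ 0 ∧ ∃ p ∈ P, ∃ q ∈ P, N • x + p = q := by
  induction hx using Submodule.span_induction with
  | mem x hx => exact ⟨1, one_ne_zero, 0, zero_mem P, x, hx, by simp⟩
  | zero => exact ⟨1, one_ne_zero, 0, zero_mem P, 0, zero_mem P, by simp⟩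
  | add x y _ _ hx hy =>
    obtain ⟨N, hN, p, hp, q, hq, h⟩ := hx
    obtain ⟨N', hN', p', hp', q', hq', h'⟩ := hy
    refine ⟨N * N', mul_ne_zero hN hN', N' • p + N • p',
      add_mem (nsmul_mem hp N') (nsmul_mem hp' N), N' • q + N • q',
      add_mem (nsmul_mem hq N') (nsmul_mem hq' N), ?_⟩
    rw [← h, ← h']
    module
  | smul c x _ hx =>
    obtain ⟨N, hN, p, hp, q, hq, h⟩ := hx
    have hc : (N * c.den) • c • x = c.num • N • x := by
      rw [mul_smul, ← Nat.cast_smul_eq_nsmul ℚ c.den, smul_smul, Rat.den_mul_eq_num,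
        Int.cast_smul_eq_zsmul, smul_comm]
    refine ⟨N * c.den, mul_ne_zero hN c.den_ne_zero, ?_⟩
    rw [hc, eq_sub_of_add_eq h]
    obtain ⟨m, hm | hm⟩ := c.num.eq_nat_or_neg
    · refine ⟨m • p, nsmul_mem hp m, m • q, nsmul_mem hq m, ?_⟩
      rw [hm]
      module
    · refine ⟨m • q, nsmul_mem hq m, m • p, nsmul_mem hp m, ?_⟩
      rw [hm]
      module

variable {R M V : Type*} [CommRing R] [AddCommMonoid M] [AddCommGroup V] [Module ℚ V]

theorem isDomain_addMonoidAlgebra_of_injective [IsDomain R] (W : M →+ V)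
    (hW : Function.Injective W) : IsDomain R[M] := by
  have : TwoUniqueSums M := TwoUniqueSums.of_injective_addHom W.toAddHom hW inferInstance
  exact NoZeroDivisors.to_isDomain _

theorem isAlgebraic_adjoin_image_single [Nontrivial R] (W : M →+ V)
    (hW : Function.Injective W) {t : Set M} {m : M}
    (hm : W m ∈ Submodule.span ℚ (W '' t)) :
    IsAlgebraic (Algebra.adjoin R ((fun u => AddMonoidAlgebra.single u (1 : R)) '' t))
      (AddMonoidAlgebra.single m (1 : R)) := by
  set B := Algebra.adjoin R ((fun u => AddMonoidAlgebra.single u (1 : R)) '' t)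
  have hB : ∀ p ∈ AddSubmonoid.closure t, AddMonoidAlgebra.single p (1 : R) ∈ B := by
    intro p hp
    induction hp using AddSubmonoid.closure_induction with
    | mem p hp => exact Algebra.subset_adjoin ⟨p, hp, rfl⟩
    | zero => exact one_mem B
    | add p q _ _ hp hq => simpa using mul_mem hp hq
  rw [← Submodule.span_closure, ← AddMonoidHom.map_mclosure] at hm
  obtain ⟨N, hN, _, ⟨p, hp, rfl⟩, _, ⟨q, hq, rfl⟩, h⟩ := exists_nsmul_add_eq_of_mem_span hm
  have hpq : N • m + p = q := hW (by simpa using h)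
  have hp0 : (⟨_, hB p hp⟩ : B) ≠ 0 := by simp [Subtype.ext_iff]
  refine ⟨Polynomial.C ⟨_, hB p hp⟩ * Polynomial.X ^ N - Polynomial.C ⟨_, hB q hq⟩,
    fun h0 => ?_, ?_⟩
  · have := congrArg (Polynomial.coeff · N) h0
    simp [Polynomial.coeff_C, hN, hp0] at this
  · simp [AddMonoidAlgebra.single_pow, AddMonoidAlgebra.single_mul_single, ← hpq, add_comm]

theorem ringKrullDim_addMonoidAlgebra_le {K : Type*} [Field K] [AddMonoid.FG M] (W : M →+ V)
    (hW : Function.Injective W) :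
    ringKrullDim K[M] ≤ finrank ℚ (Submodule.span ℚ (Set.range W)) := by
  have := isDomain_addMonoidAlgebra_of_injective (R := K) W hW
  obtain ⟨g, hg⟩ := AddMonoid.FG.fg_top (M := M)
  have hrange : Submodule.span ℚ (W '' g) = Submodule.span ℚ (Set.range W) := by
    rw [← Submodule.span_closure, ← AddMonoidHom.map_mclosure, hg, AddSubmonoid.coe_map,
      AddSubmonoid.coe_top, Set.image_univ]
  obtain ⟨b, hb, hspan, hlin⟩ := exists_linearIndependent ℚ (W '' g)
  obtain ⟨t, ht, rfl⟩ := Set.subset_image_iff.mp hb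
  set s := (fun u => AddMonoidAlgebra.single u (1 : K)) '' t
  have : Algebra.IsAlgebraic (Algebra.adjoin K s) K[M] := by
    refine ⟨fun a => ?_⟩
    induction a using AddMonoidAlgebra.induction_on with
    | of m =>
      refine isAlgebraic_adjoin_image_single W hW ?_
      rw [hspan, hrange]
      exact Submodule.subset_span ⟨m, rfl⟩
    | add x y hx hy => exact hx.add hy
    | smul c x hx =>
      simpa using hx.smul (algebraMap K (Algebra.adjoin K s) c)
  refine ringKrullDim_le_of_trdeg_le ((Algebra.IsAlgebraic.trdeg_le_cardinalMk K s).trans ?_)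
  have : Finite t := g.finite_toSet.subset ht
  have := Fintype.ofFinite (W '' t)
  rw [← hrange, ← hspan, finrank_span_set_eq_card hlin, Set.toFinset_card,
    ← Nat.card_eq_fintype_card, Nat.card_image_of_injective hW, ← Nat.cast_card]
  exact_mod_cast Nat.card_image_le t.toFinite

end AddMonoidAlgebra

section MonomialIdeal

open scoped Pointwise
open MvPolynomial

/-- The monomial ideal generated by the monomials `x ^ a` with `a ∈ A`. -/
noncomputable def monomialIdeal {σ : Type*} (R : Type*) [CommSemiring R] (A : Set (σ →₀ ℕ)) :
    Ideal (MvPolynomial σ R) :=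
  Ideal.span ((fun a => monomial a 1) '' A)

variable {σ R : Type*} [CommSemiring R] {A B : Set (σ →₀ ℕ)}

theorem monomial_mem_monomialIdeal {a : σ →₀ ℕ} (ha : a ∈ A) :
    monomial a (1 : R) ∈ monomialIdeal R A :=
  Ideal.subset_span (Set.mem_image_of_mem _ ha)

theorem monomialIdeal_mul_monomialIdeal :
    monomialIdeal R A * monomialIdeal R B = monomialIdeal R (A + B) := by
  rw [monomialIdeal, monomialIdeal, monomialIdeal, Ideal.span_mul_span', ← Set.image2_mul,
    ← Set.image2_add]
  exact congrArg Ideal.span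
    (Set.image_image2_distrib (g := fun a => monomial a (1 : R)) fun a b => by
      rw [monomial_mul, one_mul]).symm

theorem monomialIdeal_singleton_zero : monomialIdeal R ({0} : Set (σ →₀ ℕ)) = 1 := by
  rw [monomialIdeal, Set.image_singleton, Ideal.one_eq_top]
  exact Ideal.span_singleton_one

theorem monomialIdeal_le_pow_idealOfVars {D : ℕ} (hA : ∀ a ∈ A, D ≤ a.degree) :
    monomialIdeal R A ≤ idealOfVars σ R ^ D := by
  nontriviality R
  rw [monomialIdeal, Ideal.span_le]
  rintro _ ⟨a, ha, rfl⟩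
  exact (monomial_mem_pow_idealOfVars_iff D a one_ne_zero).mpr (hA a ha)

theorem monomial_mem_monomialIdeal_of_mem_support {f : MvPolynomial σ R}
    (hf : f ∈ monomialIdeal R A) {u : σ →₀ ℕ} (hu : u ∈ f.support) :
    monomial u (1 : R) ∈ monomialIdeal R A := by
  obtain ⟨a, ha, hau⟩ := mem_ideal_span_monomial_image.mp hf u hu
  rw [← tsub_add_cancel_of_le hau, ← one_mul (1 : R), ← monomial_mul]
  exact Ideal.mul_mem_left _ _ (monomial_mem_monomialIdeal ha)

theorem IsMonomialIdeal.exists_finset_of_isEquigenerated {K : Type*} [Field K] {n : ℕ}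
    {I : Ideal (MvPolynomial (Fin n) K)} (hmon : IsMonomialIdeal I) (heq : IsEquigenerated I) :
    ∃ (d : ℕ) (X : Finset (Fin n →₀ ℕ)), (∀ u ∈ X, u.degree = d) ∧ I = monomialIdeal K X := by
  obtain ⟨A, hA⟩ := hmon
  obtain ⟨d, G, hG, hI⟩ := heq
  have hfin : {u : Fin n →₀ ℕ | u.degree = d ∧ monomial u (1 : K) ∈ I}.Finite :=
    (Finset.univ.finsuppAntidiag d).finite_toSet.subset fun u hu => by
      simpa [Finsupp.degree_eq_sum] using hu.1
  refine ⟨d, hfin.toFinset, fun u hu => (hfin.mem_toFinset.mp hu).1, ?_⟩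
  rw [hfin.coe_toFinset]
  refine le_antisymm ?_ (Ideal.span_le.mpr (Set.image_subset_iff.mpr fun u hu => hu.2))
  refine hI.trans_le (Ideal.span_le.mpr fun g hg => ?_)
  have hgI : g ∈ I := hI ▸ Ideal.subset_span hg
  refine mem_ideal_span_monomial_image.mpr fun u hu => ⟨u, ⟨?_, ?_⟩, le_rfl⟩
  · rw [Finsupp.degree_eq_weight_one]
    exact hG g hg (mem_support_iff.mp hu)
  · rw [hA] at hgI ⊢
    exact monomial_mem_monomialIdeal_of_mem_support hgI hu

end MonomialIdeal

section FiberRing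

open MvPolynomial

variable {K : Type*} [Field K] {n : ℕ} (I : Ideal (MvPolynomial (Fin n) K))

/-- The class `f tᵏ` in the fiber ring of an element `f` of `Iᵏ`. -/
noncomputable def fiberMk (k : ℕ) : ↥(I ^ k) →ₗ[MvPolynomial (Fin n) K] FiberRing I :=
  (Ideal.Quotient.mkₐ (MvPolynomial (Fin n) K) (irrelevantReesIdeal I)).toLinearMap ∘ₗ
    ((Polynomial.monomial k).domRestrict (I ^ k)).codRestrict
      (Subalgebra.toSubmodule (reesAlgebra I)) fun f => reesAlgebra.monomial_mem.mpr f.2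

theorem fiberMk_mul_fiberMk {j k : ℕ} (f : ↥(I ^ j)) (g : ↥(I ^ k)) :
    fiberMk I j f * fiberMk I k g =
      fiberMk I (j + k) ⟨f * g, pow_add I j k ▸ Ideal.mul_mem_mul f.2 g.2⟩ :=
  congrArg (Ideal.Quotient.mk (irrelevantReesIdeal I)) <| Subtype.ext <|
    Polynomial.monomial_mul_monomial j k (f : MvPolynomial (Fin n) K) g

theorem algebraMap_fiberRing (f : MvPolynomial (Fin n) K) :
    algebraMap (MvPolynomial (Fin n) K) (FiberRing I) f =
      algebraMap K (FiberRing I) (constantCoeff f) := by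
  have hf : f - C (constantCoeff f) ∈ idealOfVars (Fin n) K := by
    rw [← pow_one (idealOfVars (Fin n) K), mem_pow_idealOfVars_iff']
    intro x hx
    obtain rfl : x = 0 := (Finsupp.degree_eq_zero_iff x).mp (Nat.lt_one_iff.mp hx)
    simp [constantCoeff_eq]
  have hmem := Ideal.mem_map_of_mem (algebraMap _ (reesAlgebra I)) hf
  rw [map_sub] at hmem
  exact Ideal.Quotient.eq.mpr hmem

theorem smul_fiberRing (f : MvPolynomial (Fin n) K) (x : FiberRing I) :
    f • x = constantCoeff f • x :=
  (Algebra.smul_def f x).trans <| by rw [algebraMap_fiberRing, ← Algebra.smul_def]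

theorem restrictScalars_span_fiberRing (s : Set (FiberRing I)) :
    (Submodule.span (MvPolynomial (Fin n) K) s).restrictScalars K = Submodule.span K s := by
  refine le_antisymm (fun x hx => ?_) (Submodule.span_le_restrictScalars K _ s)
  rw [Submodule.restrictScalars_mem] at hx
  induction hx using Submodule.span_induction with
  | mem x hx => exact Submodule.subset_span hx
  | zero => exact zero_mem _
  | add x y _ _ hx hy => exact add_mem hx hy
  | smul f x _ hx =>
    rw [smul_fiberRing]
    exact Submodule.smul_mem _ _ hx

theorem fiberComponent_eq_range (k : ℕ) :
    fiberComponent I k = (LinearMap.range (fiberMk I k)).restrictScalars K := by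
  ext x
  constructor
  · rintro ⟨y, ⟨f, hf, hy⟩, rfl⟩
    exact ⟨⟨f, hf⟩, congrArg (Ideal.Quotient.mk _) (Subtype.ext hy.symm)⟩
  · rintro ⟨f, rfl⟩
    exact ⟨_, ⟨f, f.2, rfl⟩, rfl⟩

variable {I}

theorem fiberComponent_eq_span {k : ℕ} {G : Set (MvPolynomial (Fin n) K)}
    (hG : I ^ k = Ideal.span G) :
    fiberComponent I k = Submodule.span K (fiberMk I k '' ((↑) ⁻¹' G)) := by
  have hspan : Submodule.span (MvPolynomial (Fin n) K) ((↑) ⁻¹' G : Set ↥(I ^ k)) = ⊤ := by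
    have hGI : G ⊆ (I ^ k : Ideal _) := hG ▸ Ideal.subset_span
    refine Submodule.map_injective_of_injective (I ^ k).subtype_injective ?_
    rw [Submodule.map_span, Submodule.map_subtype_top, Submodule.coe_subtype,
      Set.image_preimage_eq_of_subset (by simpa using hGI), hG, Ideal.submodule_span_eq]
  rw [fiberComponent_eq_range, LinearMap.range_eq_map, ← hspan, Submodule.map_span,
    restrictScalars_span_fiberRing]

theorem coeff_mem_of_mem_irrelevantReesIdeal {x : reesAlgebra I} (hx : x ∈ irrelevantReesIdeal I)
    (k : ℕ) :
    (x : Polynomial (MvPolynomial (Fin n) K)).coeff k ∈ idealOfVars (Fin n) K * I ^ k := by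
  rw [irrelevantReesIdeal, Ideal.map] at hx
  induction hx using Submodule.span_induction generalizing k with
  | mem x hx =>
    obtain ⟨f, hf, rfl⟩ := hx
    change (Polynomial.C f).coeff k ∈ _
    rw [Polynomial.coeff_C]
    split_ifs with hk
    · simpa [hk] using hf
    · exact zero_mem _
  | zero => simp
  | add x y _ _ hx hy => simpa using add_mem (hx k) (hy k)
  | smul r x _ hx =>
    rw [smul_eq_mul, Subalgebra.coe_mul, Polynomial.coeff_mul]
    refine sum_mem fun p hp => ?_
    rw [← Finset.HasAntidiagonal.mem_antidiagonal.mp hp, pow_add, mul_left_comm]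
    exact Ideal.mul_mem_mul ((mem_reesAlgebra_iff I _).mp r.2 _) (hx _)

theorem mem_idealOfVars_mul_of_fiberMk_eq_zero {k : ℕ} {f : ↥(I ^ k)} (hf : fiberMk I k f = 0) :
    (f : MvPolynomial (Fin n) K) ∈ idealOfVars (Fin n) K * I ^ k := by
  have hmem := coeff_mem_of_mem_irrelevantReesIdeal (Ideal.Quotient.eq_zero_iff_mem.mp hf) k
  exact Polynomial.coeff_monomial_same k (f : MvPolynomial (Fin n) K) ▸ hmem

theorem coeff_eq_zero_of_fiberMk_eq_zero {k : ℕ} {f : ↥(I ^ k)} (hf : fiberMk I k f = 0)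
    {w : Fin n →₀ ℕ} (hI : I ^ k ≤ idealOfVars (Fin n) K ^ w.degree) :
    coeff w (f : MvPolynomial (Fin n) K) = 0 := by
  have hmem := Ideal.mul_mono_right hI (mem_idealOfVars_mul_of_fiberMk_eq_zero hf)
  rw [← pow_succ', mem_pow_idealOfVars_iff'] at hmem
  exact hmem w (Nat.lt_succ_self _)

theorem finrank_fiberComponent {k D : ℕ} {Y : Finset (Fin n →₀ ℕ)} (hD : ∀ w ∈ Y, w.degree = D)
    (hY : I ^ k = monomialIdeal K Y) : Module.finrank K (fiberComponent I k) = Y.card := by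
  let x : Y → ↥(I ^ k) := fun w =>
    ⟨monomial w 1, hY ▸ monomial_mem_monomialIdeal (Finset.mem_coe.mpr w.2)⟩
  have hrange : Set.range x =
      (↑) ⁻¹' ((fun a => monomial a (1 : K)) '' (Y : Set (Fin n →₀ ℕ))) := by
    ext f
    simp [x, Subtype.ext_iff]
  have hlin : LinearIndependent K fun w => fiberMk I k (x w) := by
    refine Fintype.linearIndependent_iff.mpr fun c hc w => ?_
    have hle : I ^ k ≤ idealOfVars (Fin n) K ^ w.1.degree := hY ▸
      monomialIdeal_le_pow_idealOfVars fun v hv => ((hD w w.2).trans (hD v hv).symm).le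
    have hsum : fiberMk I k (∑ v, c v • x v) = 0 := by
      simp only [map_sum, LinearMap.map_smul_of_tower, hc]
    have hcoeff := coeff_eq_zero_of_fiberMk_eq_zero hsum hle
    simpa only [x, AddSubmonoidClass.coe_finsetSum, coeff_sum, Submodule.coe_smul_of_tower,
      coeff_smul, coeff_monomial, SetLike.coe_eq_coe, smul_eq_mul, mul_ite, mul_one, mul_zero,
      Finset.sum_ite_eq', Finset.mem_univ, if_true] using hcoeff
  rw [fiberComponent_eq_span hY, ← hrange, ← Set.range_comp]
  exact (finrank_span_eq_card hlin).trans (Fintype.card_coe Y)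

theorem finrank_fiberComponent_zero : Module.finrank K (fiberComponent I 0) = 1 :=
  finrank_fiberComponent (Y := {0}) (D := 0) (by simp)
    (by rw [pow_zero, Finset.coe_singleton, monomialIdeal_singleton_zero])

theorem finrank_fiberComponent_one {d : ℕ} {X : Finset (Fin n →₀ ℕ)}
    (hd : ∀ u ∈ X, u.degree = d) (hX : I = monomialIdeal K X) :
    Module.finrank K (fiberComponent I 1) = X.card :=
  finrank_fiberComponent hd ((pow_one I).trans hX)

open scoped Pointwise in
theorem finrank_fiberComponent_two [DecidableEq (Fin n →₀ ℕ)] {d : ℕ} {X : Finset (Fin n →₀ ℕ)}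
    (hd : ∀ u ∈ X, u.degree = d) (hX : I = monomialIdeal K X) :
    Module.finrank K (fiberComponent I 2) = (X + X).card := by
  refine finrank_fiberComponent (D := d + d) (fun w hw => ?_) ?_
  · obtain ⟨u, hu, v, hv, rfl⟩ := Finset.mem_add.mp hw
    rw [map_add, hd u hu, hd v hv]
  · rw [Finset.coe_add, ← monomialIdeal_mul_monomialIdeal, ← hX, sq]

theorem adjoin_fiberComponent_one :
    Algebra.adjoin K (fiberComponent I 1 : Set (FiberRing I)) = ⊤ := by
  refine Algebra.eq_top_iff.mpr fun x => ?_
  obtain ⟨⟨f, hf⟩, rfl⟩ := Ideal.Quotient.mk_surjective x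
  have hf' := adjoin_monomial_eq_reesAlgebra I ▸ hf
  induction hf' using Algebra.adjoin_induction with
  | mem g hg =>
    obtain ⟨r, hr, rfl⟩ := hg
    exact Algebra.subset_adjoin ⟨_, ⟨r, by rwa [pow_one], rfl⟩, rfl⟩
  | algebraMap r =>
    exact (algebraMap_fiberRing I r).symm ▸ Subalgebra.algebraMap_mem _ _
  | add g h hg hh ihg ihh =>
    rw [adjoin_monomial_eq_reesAlgebra] at hg hh
    exact add_mem (ihg hg) (ihh hh)
  | mul g h hg hh ihg ihh =>
    rw [adjoin_monomial_eq_reesAlgebra] at hg hh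
    exact mul_mem (ihg hg) (ihh hh)

end FiberRing

section ExponentRank

open scoped Pointwise
open Module (finrank)

variable {σ : Type*}

/-- The pair `(k, u)`, the exponent of `x ^ u tᵏ`, as a vector with rational coordinates. -/
noncomputable def exponentVector : ℕ × (σ →₀ ℕ) →+ ℚ × (σ →₀ ℚ) :=
  (Nat.castAddMonoidHom ℚ).prodMap (Finsupp.mapRange.addMonoidHom (Nat.castAddMonoidHom ℚ))

theorem exponentVector_injective : Function.Injective (exponentVector (σ := σ)) :=
  Function.Injective.prodMap Nat.cast_injective
    (Finsupp.mapRange_injective _ Nat.cast_zero Nat.cast_injective)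

/-- The rank of the exponents `(1, u)`, `u ∈ X`, of the monomials `x ^ u t`; it exceeds the
dimension of the affine hull of `X` by one if `X` is nonempty. -/
noncomputable def exponentRank (X : Set (σ →₀ ℕ)) : ℕ :=
  finrank ℚ (Submodule.span ℚ ((fun u => exponentVector (1, u)) '' X))

theorem exponentRank_le_card (X : Finset (σ →₀ ℕ)) : exponentRank (X : Set (σ →₀ ℕ)) ≤ X.card := by
  classical
  rw [exponentRank, ← Finset.coe_image]
  exact (finrank_span_finset_le_card _).trans Finset.card_image_le

theorem isAddFreimanHom_exponentVector_one (A : Set (σ →₀ ℕ)) :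
    IsAddFreimanHom 2 A Set.univ fun u => exponentVector (1, u) := by
  refine isAddFreimanHom_two.mpr ⟨Set.mapsTo_univ _ A, fun a _ b _ c _ d _ habcd => ?_⟩
  simp only [← map_add, Prod.mk_add_mk, habcd]

theorem exponentRank_mul_card_le [DecidableEq (σ →₀ ℕ)] (X : Finset (σ →₀ ℕ)) :
    exponentRank (X : Set (σ →₀ ℕ)) * X.card ≤
      (X + X).card + (exponentRank (X : Set (σ →₀ ℕ))).choose 2 := by
  classical
  let _ : LinearOrder σ := linearOrderOfSTO WellOrderingRel
  have hfreiman := finrank_span_image_mul_card_le (k := ℚ) (X.image toLex)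
    (f := fun u : Lex (σ →₀ ℕ) => exponentVector (1, ofLex u))
    (isAddFreimanHom_exponentVector_one _)
  have hadd : X.image toLex + X.image toLex = (X + X).image toLex :=
    (Finset.image_add (toLexAddEquiv (σ →₀ ℕ))).symm
  rwa [hadd, Finset.card_image_of_injective _ toLex.injective,
    Finset.card_image_of_injective _ toLex.injective, Finset.coe_image, Set.image_image] at hfreiman

end ExponentRank

section AnalyticSpread

open MvPolynomial
open scoped AddMonoidAlgebra

variable {K : Type*} [Field K] {n : ℕ}

/-- The pairs `(k, u)` such that `x ^ u tᵏ` lies in the Rees ring of `I`. -/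
def reesExponents (I : Ideal (MvPolynomial (Fin n) K)) : AddSubmonoid (ℕ × (Fin n →₀ ℕ)) where
  carrier := {p | monomial p.2 1 ∈ I ^ p.1}
  zero_mem' := by simp
  add_mem' {p q} hp hq := by
    have hpq := Ideal.mul_mem_mul hp hq
    rwa [monomial_mul, one_mul, ← pow_add] at hpq

/-- The class of `x ^ u tᵏ` in the fiber ring, as a multiplicative function of `(k, u)`. -/
noncomputable def fiberMonomial (I : Ideal (MvPolynomial (Fin n) K)) :
    Multiplicative (reesExponents I) →* FiberRing I where
  toFun p := fiberMk I p.toAdd.1.1 ⟨monomial p.toAdd.1.2 1, p.toAdd.2⟩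
  map_one' := rfl
  map_mul' p q := by
    rw [fiberMk_mul_fiberMk]
    simp only [monomial_mul, one_mul]
    rfl

theorem ringKrullDim_fiberRing_le_exponentRank {I : Ideal (MvPolynomial (Fin n) K)}
    {X : Finset (Fin n →₀ ℕ)} (hX : I = monomialIdeal K X) :
    ringKrullDim (FiberRing I) ≤ exponentRank (X : Set (Fin n →₀ ℕ)) := by
  set S : Set (ℕ × (Fin n →₀ ℕ)) := (fun u => (1, u)) '' X
  set P := AddSubmonoid.closure S
  have hP : P ≤ reesExponents I := by
    refine AddSubmonoid.closure_le.mpr (Set.image_subset_iff.mpr fun u hu => ?_)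
    change monomial u 1 ∈ I ^ 1
    rw [pow_one, hX]
    exact monomial_mem_monomialIdeal hu
  have : AddMonoid.FG P :=
    (AddMonoid.fg_iff_addSubmonoid_fg P).mpr ⟨X.map ⟨_, Prod.mk_right_injective 1⟩, by simp [P, S]⟩
  let φ : K[P] →ₐ[K] FiberRing I := AddMonoidAlgebra.lift K (FiberRing I) P
    ((fiberMonomial I).comp (AddSubmonoid.inclusion hP).toMultiplicative)
  have hφ : Function.Surjective φ := by
    rw [← AlgHom.range_eq_top, eq_top_iff, ← adjoin_fiberComponent_one,
      Algebra.adjoin_le_iff, fiberComponent_eq_span ((pow_one I).trans hX)]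
    refine (Submodule.span_le (p := Subalgebra.toSubmodule φ.range)).mpr ?_
    rintro _ ⟨⟨_, _⟩, ⟨u, hu, rfl⟩, rfl⟩
    refine ⟨AddMonoidAlgebra.single ⟨(1, u), AddSubmonoid.subset_closure ⟨u, hu, rfl⟩⟩ 1, ?_⟩
    exact AddMonoidAlgebra.lift_single _ _ _ |>.trans (one_smul K _)
  have hrange : Submodule.span ℚ (Set.range (exponentVector.comp P.subtype)) =
      Submodule.span ℚ ((fun u => exponentVector (1, u)) '' (X : Set (Fin n →₀ ℕ))) := by
    rw [AddMonoidHom.coe_comp, AddSubmonoid.coe_subtype, Set.range_comp, Subtype.range_coe,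
      ← AddSubmonoid.coe_map, AddMonoidHom.map_mclosure, Submodule.span_closure, Set.image_image]
  rw [exponentRank, ← hrange]
  exact (ringKrullDim_le_of_surjective φ.toRingHom hφ).trans
    (ringKrullDim_addMonoidAlgebra_le _ (exponentVector_injective.comp Subtype.val_injective))

end AnalyticSpread

section HVector

theorem coeff_two_one_sub_X_pow_mul {R : Type*} [CommRing R] (l : ℕ) (f : PowerSeries R) :
    PowerSeries.coeff 2 ((1 - PowerSeries.X) ^ l * f) =
      PowerSeries.coeff 2 f - l * PowerSeries.coeff 1 f + l.choose 2 * PowerSeries.coeff 0 f := by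
  induction l generalizing f with
  | zero => simp
  | succ l ih =>
    rw [pow_succ, mul_assoc, ih, Nat.choose_succ_succ', Nat.choose_one_right, sub_mul, one_mul]
    simp only [map_sub, PowerSeries.coeff_zero_X_mul, PowerSeries.coeff_succ_X_mul 1 f,
      PowerSeries.coeff_succ_X_mul 0 f]
    push_cast
    ring

theorem mul_le_add_choose_two_of_le {l r q s : ℕ} (hlr : l ≤ r) (hrq : r ≤ q)
    (h : r * q ≤ s + r.choose 2) : l * q ≤ s + l.choose 2 := by
  induction r, hlr using Nat.le_induction with
  | base => exact h
  | succ r _ ih =>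
    refine ih (by omega) ?_
    rw [Nat.choose_succ_succ', Nat.choose_one_right] at h
    linarith

end HVector

theorem corollary2p6 {K : Type*} [Field K] {n : ℕ} (I : Ideal (MvPolynomial (Fin n) K))
    (hmon : IsMonomialIdeal I) (heq : IsEquigenerated I) :
    0 ≤ fiberHVector I 2 := by
  obtain ⟨d, X, hd, hX⟩ := hmon.exists_finset_of_isEquigenerated heq
  have hspread : analyticSpread I ≤ exponentRank (X : Set (Fin n →₀ ℕ)) := by
    exact_mod_cast coe_analyticSpread I ▸ ringKrullDim_fiberRing_le_exponentRank hX
  have hbound := mul_le_add_choose_two_of_le hspread (exponentRank_le_card X)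
    (exponentRank_mul_card_le X)
  rw [← finrank_fiberComponent_one hd hX, ← finrank_fiberComponent_two hd hX] at hbound
  rw [fiberHVector, coeff_two_one_sub_X_pow_mul]
  simp only [fiberHilbertSeries, PowerSeries.coeff_mk, finrank_fiberComponent_zero]
  zify at hbound
  push_cast
  linarith
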